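/- Let $\mathcal H=\mathbb C^{d_1}\otimes\cdots\otimes\mathbb C^{d_n}$ be the Hilbert space of a multipartite system. A pure state (unit vector) of $\mathcal H$ is called entangled if it is not completely product, i.e. not of the form $v_1\otimes\cdots\otimes v_n$. An unextendible entangled basis (UEB) is a set $S\subset\mathcal H$ of mutually orthonormal entangled pure states such that the orthogonal complement of $\operatorname{span}S$ contains no entangled state (so that every state in it is completely product). A member $\psi\in S$ is called locally unambiguously identifiable with nonzero probability if, when the system is secretly prepared in some member of $S$, there is a (finite-round) LOCC protocol, each of whose outcomes either announces a state or is inconclusive, that never announces a wrong state, whichever member of $S$ was prepared, and that announces $\psi$ with nonzero probability when $\psi$ was prepared. Let $S$ be a UEB of $\mathcal H$ and let $\psi\in S$ be locally unambiguously identifiable with nonzero probability. Then: 1. $\psi$ is not a state of a three-party system (three qubits or, more generally, three parties $A,B,C$, in any order, of arbitrary local dimensions) of the form $$\psi=c\,\alpha_A\otimes\Phi_{BC}+e\,\alpha^\perp_A\otimes\Phi^\perp_{BC},$$ where $c,e$ are nonzero real numbers with $c^2+e^2=1$; $\alpha,\alpha^\perp$ are orthogonal unit vectors and $\Phi,\Phi^\perp$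 are orthogonal unit vectors; $\Phi$ is an entangled state with a Schmidt decomposition $\Phi=s\,u\otimes v+t\,u'\otimes v'$ ($s,t$ nonzero reals with $s^2+t^2=1$, $u\perp u'$ and $v\perp v'$ unit vectors); and $\Phi^\perp$ is a product state that is orthogonal to both $u\otimes v$ and $u'\otimes v'$. 2. There is no bipartition of the parties into two nonempty groups across which $\psi$ has Schmidt rank at least three, where the Schmidt rank across a bipartition is the minimum number of vectors, each product across that bipartition, whose sum is $\psi$. -/

import Mathlib

noncomputable section

/-- The Hilbert space of an `n`-partite system with local dimensions `d 0, …, d (n-1)`, that is,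
`ℂ^{d 0} ⊗ ⋯ ⊗ ℂ^{d (n-1)}`, a vector being given by its amplitudes in the computational basis
(the basis vectors are indexed by the strings `x` with `x i ∈ {0, …, d i - 1}`). -/
abbrev MultiSpace {n : ℕ} (d : Fin n → ℕ) : Type :=
  EuclideanSpace ℂ ((i : Fin n) → Fin (d i))

/-- The vector is a completely product vector: a multiple of `v 0 ⊗ ⋯ ⊗ v (n-1)`. -/
def IsProductVector {n : ℕ} {d : Fin n → ℕ} (ψ : MultiSpace d) : Prop :=
  ∃ (a : ℂ) (v : (i : Fin n) → EuclideanSpace ℂ (Fin (d i))), ∀ x, ψ x = a * ∏ i, v i (x i)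

/-- An entangled pure state: a unit vector that is not a completely product vector. -/
def IsEntangledState {n : ℕ} {d : Fin n → ℕ} (ψ : MultiSpace d) : Prop :=
  ‖ψ‖ = 1 ∧ ¬ IsProductVector ψ

/-- An unextendible entangled basis: orthonormal entangled pure states such that the orthogonal
complement of their span contains no entangled state. -/
structure IsUEB {n : ℕ} {d : Fin n → ℕ} (S : Set (MultiSpace d)) : Prop where
  orthonormal : Orthonormal ℂ (fun φ : S => (φ : MultiSpace d))
  entangled : ∀ φ ∈ S, IsEntangledState φ
  unextendible : ∀ φ ∈ (Submodule.span ℂ S)ᗮ, ¬ IsEntangledState φ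

/-- `ψ` is a sum of `r` product vectors across the bipartition `T : Tᶜ` of the parties. -/
def IsSumOfBipartiteProducts {n : ℕ} {d : Fin n → ℕ} (T : Finset (Fin n)) (ψ : MultiSpace d)
    (r : ℕ) : Prop :=
  ∃ (u : Fin r → ((i : {i : Fin n // i ∈ T}) → Fin (d i)) → ℂ)
    (v : Fin r → ((i : {i : Fin n // i ∉ T}) → Fin (d i)) → ℂ),
    ∀ x : (i : Fin n) → Fin (d i), ψ x = ∑ j, u j (fun i => x i) * v j (fun i => x i)

/-- Every vector is a finite sum of products across every bipartition, so that the minimum in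
`schmidtRank` is attained. -/
theorem exists_isSumOfBipartiteProducts {n : ℕ} {d : Fin n → ℕ} (T : Finset (Fin n))
    (ψ : MultiSpace d) : ∃ r, IsSumOfBipartiteProducts T ψ r := by
  classical
  let e := Fintype.equivFin ((i : Fin n) → Fin (d i))
  refine ⟨Fintype.card ((i : Fin n) → Fin (d i)),
    fun j y => if y = (fun i : {i : Fin n // i ∈ T} => e.symm j i.1) then ψ (e.symm j) else 0,
    fun j z => if z = (fun i : {i : Fin n // i ∉ T} => e.symm j i.1) then 1 else 0, fun x => ?_⟩
  rw [Finset.sum_eq_single (e x)]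
  · simp
  · intro j _ hj
    by_cases h1 : (fun i : {i : Fin n // i ∈ T} => x i) =
        fun i : {i : Fin n // i ∈ T} => e.symm j i.val
    · by_cases h2 : (fun i : {i : Fin n // i ∉ T} => x i) =
        fun i : {i : Fin n // i ∉ T} => e.symm j i.val
      · exfalso
        apply hj
        have : x = e.symm j := by
          funext i
          by_cases hi : i ∈ T
          · exact congrFun h1 ⟨i, hi⟩
          · exact congrFun h2 ⟨i, hi⟩
        rw [this, Equiv.apply_symm_apply]
      · exact mul_eq_zero_of_right _ (if_neg h2)
    · exact mul_eq_zero_of_left (if_neg h1) _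
  · intro h
    exact absurd (Finset.mem_univ _) h

/-- The Schmidt rank of `ψ` across the bipartition `T : Tᶜ`: the minimum number of product vectors
across that bipartition that are needed to express `ψ`. -/
def schmidtRank {n : ℕ} {d : Fin n → ℕ} (T : Finset (Fin n)) (ψ : MultiSpace d) : ℕ :=
  sInf {r | IsSumOfBipartiteProducts T ψ r}

/-- The product vector `u ⊗ v` of two parties. -/
def tensorTwo {p q : ℕ} (u : EuclideanSpace ℂ (Fin p)) (v : EuclideanSpace ℂ (Fin q)) :
    EuclideanSpace ℂ (Fin p × Fin q) :=
  WithLp.toLp 2 (fun z => u z.1 * v z.2)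

/-- `Φ` is a bipartite entangled state given by a Schmidt decomposition
`Φ = s u ⊗ v + t u' ⊗ v'` with two nonzero terms, and `χ` is orthogonal to both of the product
states `u ⊗ v` and `u' ⊗ v'` in it. -/
def HasSchmidtTermsOrthogonalTo {p q : ℕ} (Φ χ : EuclideanSpace ℂ (Fin p × Fin q)) : Prop :=
  ∃ (s t : ℝ) (u u' : EuclideanSpace ℂ (Fin p)) (v v' : EuclideanSpace ℂ (Fin q)),
    s ≠ 0 ∧ t ≠ 0 ∧ s ^ 2 + t ^ 2 = 1 ∧
    ‖u‖ = 1 ∧ ‖u'‖ = 1 ∧ inner ℂ u u' = 0 ∧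
    ‖v‖ = 1 ∧ ‖v'‖ = 1 ∧ inner ℂ v v' = 0 ∧
    Φ = (s : ℂ) • tensorTwo u v + (t : ℂ) • tensorTwo u' v' ∧
    inner ℂ (tensorTwo u v) χ = 0 ∧ inner ℂ (tensorTwo u' v') χ = 0

/-- `ψ` is a state of three parties `A`, `B`, `C` (in some order) of the form
`c α_A ⊗ Φ_{BC} + e α'_A ⊗ Φ'_{BC}` with `c`, `e` real and nonzero, `c ^ 2 + e ^ 2 = 1`, `α ⊥ α'`
and `Φ ⊥ Φ'` unit vectors, where `Φ` is an entangled state, `Φ'` is a product state, and `Φ'` is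
orthogonal to both of the product states in a two-term Schmidt decomposition of `Φ`. -/
def HasRobustTripartiteForm {n : ℕ} {d : Fin n → ℕ} (ψ : MultiSpace d) : Prop :=
  ∃ A B C : Fin n, A ≠ B ∧ A ≠ C ∧ B ≠ C ∧ (∀ i, i = A ∨ i = B ∨ i = C) ∧
    ∃ (c e : ℝ) (α α' : EuclideanSpace ℂ (Fin (d A)))
      (Φ Φ' : EuclideanSpace ℂ (Fin (d B) × Fin (d C))),
      c ≠ 0 ∧ e ≠ 0 ∧ c ^ 2 + e ^ 2 = 1 ∧
      ‖α‖ = 1 ∧ ‖α'‖ = 1 ∧ inner ℂ α α' = 0 ∧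
      ‖Φ‖ = 1 ∧ ‖Φ'‖ = 1 ∧ inner ℂ Φ Φ' = 0 ∧
      (¬ ∃ β γ, Φ = tensorTwo β γ) ∧ (∃ β γ, Φ' = tensorTwo β γ) ∧
      HasSchmidtTermsOrthogonalTo Φ Φ' ∧
      ∀ x, ψ x = (c : ℂ) * (α (x A) * Φ (x B, x C)) + (e : ℂ) * (α' (x A) * Φ' (x B, x C))

/-- The action of the local operator `M 0 ⊗ ⋯ ⊗ M (n-1)` on a vector; the local dimensions may
change from `d i` to `d' i`. -/
def applyLocal {n : ℕ} {d d' : Fin n → ℕ} (M : (i : Fin n) → Matrix (Fin (d' i)) (Fin (d i)) ℂ)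
    (ψ : MultiSpace d) : MultiSpace d' :=
  WithLp.toLp 2 (fun y => ∑ x, (∏ i, M i (y i) (x i)) * ψ x)

/-- LOCC protocols with finitely many rounds, on a system with local dimensions `d`, ending in a
classical outcome in `G`. Either the protocol stops and announces an outcome, or some party `k`
performs a measurement on her own system (with Kraus operators `K j k`, complete in the sense that
`∑ j, (K j k)ᴴ * K j k = 1`) and announces its outcome `j`, whereupon every other party `i` applies
a local isometry `K j i` that may depend on `j` (possibly the identity, possibly adding an ancilla),
and the protocol continues in a way that may depend on `j`. All the other operations that local
parties can do (randomization, discarding a subsystem, measurements with coarse-grained outcomes)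
arise from these, by ignoring some of the information announced. -/
inductive LOCCProtocol {n : ℕ} (G : Type) : (Fin n → ℕ) → Type
  | halt {d : Fin n → ℕ} (g : G) : LOCCProtocol G d
  | step {d : Fin n → ℕ} (k : Fin n) (m : ℕ) (d' : Fin m → Fin n → ℕ)
      (K : (j : Fin m) → (i : Fin n) → Matrix (Fin (d' j i)) (Fin (d i)) ℂ)
      (complete : ∑ j, (K j k).conjTranspose * K j k = 1)
      (isometric : ∀ j i, i ≠ k → (K j i).conjTranspose * K j i = 1)
      (next : (j : Fin m) → LOCCProtocol G (d' j)) : LOCCProtocol G d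

open Classical in
/-- The probability that the protocol ends with the outcome `g` when the system is prepared in the
state `ψ` (for a subnormalized `ψ`, this is the probability weighted by `‖ψ‖ ^ 2`). -/
def LOCCProtocol.prob {n : ℕ} {G : Type} (g : G) :
    {d : Fin n → ℕ} → LOCCProtocol G d → MultiSpace d → ℝ
  | _, .halt g', ψ => if g' = g then ‖ψ‖ ^ 2 else 0
  | _, .step _ _ _ K _ _ next, ψ => ∑ j, (next j).prob g (applyLocal (K j) ψ)

/-- The member `ψ` of `S` is locally unambiguously identifiable with nonzero probability, when the
system is prepared in an unknown member of `S`: there is an LOCC protocol whose outcome is either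
the inconclusive `none` or the announcement `some φ` of a state, which never announces a wrong state
(whichever member of `S` was prepared), and which announces `ψ` with nonzero probability when `ψ`
was prepared. -/
def IsLocallyUnambiguouslyIdentifiable {n : ℕ} {d : Fin n → ℕ} (S : Set (MultiSpace d))
    (ψ : MultiSpace d) : Prop :=
  ∃ P : LOCCProtocol (Option (MultiSpace d)) d,
    (∀ χ ∈ S, ∀ φ, φ ≠ χ → P.prob (some φ) χ = 0) ∧ 0 < P.prob (some ψ) ψ

end

/-! Each branch of an LOCC protocol acts by a product operator, so a branch that announces `ψ`
yields a product vector `η` orthogonal to every other member of `S` but not to `ψ`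
(`LOCCProtocol.exists_product_functional`). Then `η - ⟨ψ, η⟩ ψ` is orthogonal to all of `S`, hence
itself product by unextendibility, and `ψ` is a sum of two product vectors
(`IsUEB.exists_eq_add_of_identifiable`).

Such a sum has Schmidt rank at most two across every cut. For the tripartite form, pairing party `A`
with `α` and `α'` puts `Φ` and `Φ'` in the span of the same two products on `BC`; a 2×2 determinant
argument excludes this (`HasSchmidtTermsOrthogonalTo.not_mem_span_products`). -/

theorem LOCCProtocol.prob_nonneg {n : ℕ} {G : Type} (g : G) {d : Fin n → ℕ}
    (P : LOCCProtocol G d) (ψ : MultiSpace d) : 0 ≤ P.prob g ψ := by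
  induction P with
  | halt g' =>
    rw [LOCCProtocol.prob]
    split_ifs <;> positivity
  | step k m d' K _ _ next ih =>
    rw [LOCCProtocol.prob]
    exact Finset.sum_nonneg fun j _ => ih j _

/-- A product functional applied after local operators is again a product functional. -/
theorem sum_prod_mul_applyLocal {n : ℕ} {d d' : Fin n → ℕ}
    (M : (i : Fin n) → Matrix (Fin (d' i)) (Fin (d i)) ℂ) (w : (i : Fin n) → Fin (d' i) → ℂ)
    (ψ : MultiSpace d) :
    ∑ y, (∏ i, w i (y i)) * applyLocal M ψ y =
      ∑ x, (∏ i, ∑ b, w i b * M i b (x i)) * ψ x := by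
  have h : ∀ x : (i : Fin n) → Fin (d i), (∏ i, ∑ b, w i b * M i b (x i)) =
      ∑ y : (i : Fin n) → Fin (d' i), (∏ i, w i (y i)) * ∏ i, M i (y i) (x i) := by
    intro x
    rw [Finset.prod_univ_sum, Fintype.piFinset_univ]
    exact Finset.sum_congr rfl fun y _ => Finset.prod_mul_distrib
  simp only [applyLocal, h, Finset.mul_sum, Finset.sum_mul]
  rw [Finset.sum_comm]
  simp only [mul_assoc]

/-- If a protocol announces `g` with nonzero probability on `ψ`, then some product functional is
nonzero at `ψ` and vanishes at every state on which `g` is never announced. -/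
theorem LOCCProtocol.exists_product_functional {n : ℕ} {G : Type} (g : G) {d : Fin n → ℕ}
    (P : LOCCProtocol G d) (ψ : MultiSpace d) (hψ : 0 < P.prob g ψ) :
    ∃ w : (i : Fin n) → Fin (d i) → ℂ, ∑ x, (∏ i, w i (x i)) * ψ x ≠ 0 ∧
      ∀ χ : MultiSpace d, P.prob g χ = 0 → ∑ x, (∏ i, w i (x i)) * χ x = 0 := by
  classical
  induction P with
  | @halt d g' =>
    rw [LOCCProtocol.prob] at hψ
    split_ifs at hψ with hg
    · have hψ0 : ψ ≠ 0 := by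
        rintro rfl
        simp at hψ
      obtain ⟨y, hy⟩ : ∃ y, ψ y ≠ 0 := by
        by_contra! h
        exact hψ0 (PiLp.ext h)
      -- Evaluating an amplitude at a fixed basis string is a product functional.
      have hprod : ∀ (χ : MultiSpace d),
          ∑ x, (∏ i, (Pi.single (y i) 1 : Fin (d i) → ℂ) (x i)) * χ x = χ y := by
        intro χ
        rw [Finset.sum_eq_single y]
        · simp
        · intro x _ hx
          obtain ⟨i, hi⟩ := Function.ne_iff.mp hx
          rw [Finset.prod_eq_zero (Finset.mem_univ i) (Pi.single_eq_of_ne hi _), zero_mul]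
        · intro h
          exact absurd (Finset.mem_univ _) h
      refine ⟨fun i => Pi.single (y i) 1, by rwa [hprod], fun χ hχ => ?_⟩
      rw [LOCCProtocol.prob, if_pos hg] at hχ
      have : χ = 0 := by simpa using hχ
      rw [hprod, this]
      rfl
    · exact absurd hψ (lt_irrefl 0)
  | step k m d' K _ _ next ih =>
    rw [LOCCProtocol.prob] at hψ
    obtain ⟨j, -, hj⟩ : ∃ j ∈ Finset.univ, 0 < (next j).prob g (applyLocal (K j) ψ) := by
      by_contra! h
      exact absurd hψ (not_lt.mpr (Finset.sum_nonpos h))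
    obtain ⟨w, hw, hw0⟩ := ih j _ hj
    -- The functional for the rest of the branch, pulled back along the Kraus operator of outcome
    -- `j`.
    refine ⟨fun i a => ∑ b, w i b * K j i b a, ?_, fun χ hχ => ?_⟩
    · rwa [← sum_prod_mul_applyLocal]
    -- The branch probabilities are nonnegative, so a zero total makes the chosen branch zero too.
    · rw [LOCCProtocol.prob,
        Finset.sum_eq_zero_iff_of_nonneg fun j _ => LOCCProtocol.prob_nonneg g _ _] at hχ
      rw [← sum_prod_mul_applyLocal]
      exact hw0 _ (hχ j (Finset.mem_univ j))

/-! ### Identifiable members as sums of two product vectors -/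

theorem IsProductVector.smul {n : ℕ} {d : Fin n → ℕ} {φ : MultiSpace d} (h : IsProductVector φ)
    (b : ℂ) : IsProductVector (b • φ) := by
  obtain ⟨a, v, hv⟩ := h
  exact ⟨b * a, v, fun x => by rw [PiLp.smul_apply, hv, smul_eq_mul, mul_assoc]⟩

/-- Unextendibility speaks of unit vectors only; rescaling removes the normalization, and zero is
trivially product. -/
theorem IsUEB.isProductVector {n : ℕ} {d : Fin n → ℕ} {S : Set (MultiSpace d)} (hS : IsUEB S)
    {φ : MultiSpace d} (hφ : φ ∈ (Submodule.span ℂ S)ᗮ) : IsProductVector φ := by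
  by_cases h0 : φ = 0
  · exact ⟨0, fun _ => 0, fun x => by simp [h0]⟩
  · have hn : (‖φ‖ : ℂ) ≠ 0 := by simpa using h0
    have h1 : IsProductVector ((‖φ‖ : ℂ)⁻¹ • φ) := by
      by_contra h
      refine hS.unextendible _ (Submodule.smul_mem _ _ hφ) ⟨?_, h⟩
      rw [norm_smul, norm_inv, Complex.norm_real, norm_norm, inv_mul_cancel₀ (norm_ne_zero_iff.mpr h0)]
    simpa [smul_smul, hn] using h1.smul (‖φ‖ : ℂ)

/-- An identifiable member of an unextendible entangled basis is a sum of two product vectors. -/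
theorem IsUEB.exists_eq_add_of_identifiable {n : ℕ} {d : Fin n → ℕ} {S : Set (MultiSpace d)}
    (hS : IsUEB S) {ψ : MultiSpace d} (hψ : ψ ∈ S) (hid : IsLocallyUnambiguouslyIdentifiable S ψ) :
    ∃ η ω : MultiSpace d, IsProductVector η ∧ IsProductVector ω ∧ ψ = η + ω := by
  obtain ⟨P, hP, hpos⟩ := hid
  obtain ⟨w, hw, hw0⟩ := P.exists_product_functional _ ψ hpos
  -- The Riesz vector of the functional `w`; conjugating factor by factor keeps it product.
  let η : MultiSpace d := WithLp.toLp 2 fun x => ∏ i, star (w i (x i))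
  have hη : IsProductVector η :=
    ⟨1, fun i => WithLp.toLp 2 fun a => star (w i a), fun x => by simp [η]⟩
  have hinner : ∀ χ : MultiSpace d, inner ℂ χ η = star (∑ x, (∏ i, w i (x i)) * χ x) := by
    intro χ
    simp [η, PiLp.inner_apply]
  have ha : inner ℂ ψ η ≠ 0 := by
    rw [hinner]
    exact star_ne_zero.mpr hw
  have hψψ : inner ℂ ψ ψ = (1 : ℂ) := by
    rw [inner_self_eq_norm_sq_to_K, (hS.entangled ψ hψ).1]
    simp
  have hω : η - inner ℂ ψ η • ψ ∈ (Submodule.span ℂ S)ᗮ := by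
    rw [Submodule.mem_orthogonal]
    intro χ hχ
    induction hχ using Submodule.span_induction with
    | mem χ hχ =>
      rw [inner_sub_right, inner_smul_right]
      by_cases h : ψ = χ
      · rw [← h, hψψ, mul_one, sub_self]
      · have h1 : inner ℂ χ ψ = (0 : ℂ) :=
          hS.orthonormal.2 (i := ⟨χ, hχ⟩) (j := ⟨ψ, hψ⟩) fun h' => h (congrArg Subtype.val h').symm
        rw [h1, mul_zero, sub_zero, hinner, hw0 χ (hP χ hχ ψ h), star_zero]
    | zero => exact inner_zero_left _
    | add x y _ _ hx hy => rw [inner_add_left, hx, hy, add_zero]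
    | smul a x _ hx => rw [inner_smul_left, hx, mul_zero]
  refine ⟨_, _, hη.smul (inner ℂ ψ η)⁻¹, (hS.isProductVector hω).smul (-(inner ℂ ψ η)⁻¹), ?_⟩
  rw [smul_sub, smul_smul, neg_smul, neg_mul, inv_mul_cancel₀ ha, neg_smul, one_smul]
  abel

/-! ### Schmidt rank across a bipartition -/

theorem IsProductVector.exists_bipartite_product {n : ℕ} {d : Fin n → ℕ} {φ : MultiSpace d}
    (h : IsProductVector φ) (T : Finset (Fin n)) :
    ∃ (u : ((i : {i : Fin n // i ∈ T}) → Fin (d i)) → ℂ)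
      (v : ((i : {i : Fin n // i ∉ T}) → Fin (d i)) → ℂ),
      ∀ x : (i : Fin n) → Fin (d i), φ x = u (fun i => x i) * v (fun i => x i) := by
  obtain ⟨a, v, hv⟩ := h
  refine ⟨fun y => a * ∏ i, v i.1 (y i), fun z => ∏ i, v i.1 (z i), fun x => ?_⟩
  rw [hv, ← Fintype.prod_subtype_mul_prod_subtype (fun i => i ∈ T) fun i => v i (x i), mul_assoc]
  congr!

theorem schmidtRank_add_le_two {n : ℕ} {d : Fin n → ℕ} {η ω : MultiSpace d}
    (hη : IsProductVector η) (hω : IsProductVector ω) (T : Finset (Fin n)) :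
    schmidtRank T (η + ω) ≤ 2 := by
  obtain ⟨u, v, h⟩ := hη.exists_bipartite_product T
  obtain ⟨u', v', h'⟩ := hω.exists_bipartite_product T
  exact Nat.sInf_le ⟨![u, u'], ![v, v'], fun x => by simp [Fin.sum_univ_two, h, h']⟩

/-! ### The two-party obstruction -/

theorem inner_tensorTwo_tensorTwo {p q : ℕ} (u β : EuclideanSpace ℂ (Fin p))
    (v γ : EuclideanSpace ℂ (Fin q)) :
    inner ℂ (tensorTwo u v) (tensorTwo β γ) = inner ℂ u β * inner ℂ v γ := by
  simp only [PiLp.inner_apply, tensorTwo, Fintype.sum_prod_type, Finset.sum_mul_sum,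
    RCLike.inner_apply, map_mul]
  exact Finset.sum_congr rfl fun _ _ => Finset.sum_congr rfl fun _ _ => by ring

theorem inner_self_eq_one_of_norm {E : Type*} [NormedAddCommGroup E] [InnerProductSpace ℂ E]
    {u : E} (h : ‖u‖ = 1) : inner ℂ u u = (1 : ℂ) := by
  rw [inner_self_eq_norm_sq_to_K, h]
  simp

/-- If a nonzero product vector is orthogonal to both terms of a two-term Schmidt decomposition of
`Φ`, then it does not lie together with `Φ` in the span of two product vectors. -/
theorem HasSchmidtTermsOrthogonalTo.not_mem_span_products {p q : ℕ}
    {Φ : EuclideanSpace ℂ (Fin p × Fin q)} {β : EuclideanSpace ℂ (Fin p)}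
    {γ : EuclideanSpace ℂ (Fin q)} (h : HasSchmidtTermsOrthogonalTo Φ (tensorTwo β γ))
    (hne : tensorTwo β γ ≠ 0) {b b' : EuclideanSpace ℂ (Fin p)} {g g' : EuclideanSpace ℂ (Fin q)}
    {k k' l l' : ℂ} (h1 : Φ = k • tensorTwo b g + k' • tensorTwo b' g')
    (h2 : tensorTwo β γ = l • tensorTwo b g + l' • tensorTwo b' g') : False := by
  obtain ⟨s, t, u, u', v, v', hs, ht, -, hu, hu', huu, hv, hv', hvv, hΦ, o1, o2⟩ := h
  have huu' : inner ℂ u' u = (0 : ℂ) := inner_eq_zero_symm.mp huu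
  have hvv' : inner ℂ v' v = (0 : ℂ) := inner_eq_zero_symm.mp hvv
  have hst : (s : ℂ) * t ≠ 0 := by exact_mod_cast mul_ne_zero hs ht
  -- Compress to the 2×2 matrices of coefficients against `u, u'` and `v, v'`: `Φ` becomes `diag(s,
  -- t)`, and `β ⊗ γ` has zero diagonal.
  have e (y : EuclideanSpace ℂ (Fin p)) (z : EuclideanSpace ℂ (Fin q)) :=
    congrArg (inner ℂ (tensorTwo y z)) (hΦ.symm.trans h1)
  have f (y : EuclideanSpace ℂ (Fin p)) (z : EuclideanSpace ℂ (Fin q)) :=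
    congrArg (inner ℂ (tensorTwo y z)) h2
  simp only [inner_add_right, inner_smul_right, inner_tensorTwo_tensorTwo] at e f o1 o2
  have e11 := e u v
  have e12 := e u v'
  have e21 := e u' v
  have e22 := e u' v'
  have f11 := f u v
  have f12 := f u v'
  have f21 := f u' v
  have f22 := f u' v'
  simp only [inner_self_eq_one_of_norm hu, inner_self_eq_one_of_norm hu',
    inner_self_eq_one_of_norm hv, inner_self_eq_one_of_norm hv', huu, huu', hvv, hvv', mul_zero,
    mul_one, add_zero, zero_add] at e11 e12 e21 e22
  rw [o1] at f11
  rw [o2] at f22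
  generalize inner ℂ u b = p₁, inner ℂ u' b = p₂, inner ℂ u b' = q₁, inner ℂ u' b' = q₂,
    inner ℂ v g = x₁, inner ℂ v' g = x₂, inner ℂ v g' = y₁, inner ℂ v' g' = y₂ at *
  -- Both determinants share the factor in `p, q, x, y`. It is nonzero because `Φ` has determinant
  -- `s * t`, while `β ⊗ γ` has rank at most one and so determinant zero; hence `l * l' = 0`.
  have hdet : k * k' * ((p₁ * q₂ - p₂ * q₁) * (x₁ * y₂ - x₂ * y₁)) = (s : ℂ) * t := by
    linear_combination -(t : ℂ) * e11 - (k * (p₁ * x₁) + k' * (q₁ * y₁)) * e22 +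
      (k * (p₂ * x₁) + k' * (q₂ * y₁)) * e12
  have hdet' : l * l' * ((p₁ * q₂ - p₂ * q₁) * (x₁ * y₂ - x₂ * y₁)) = 0 := by
    linear_combination -(l * (p₂ * x₂) + l' * (q₂ * y₂)) * f11 + f12 * inner ℂ u' β * inner ℂ v γ +
      (l * (p₁ * x₂) + l' * (q₁ * y₂)) * f21 - inner ℂ u' β * inner ℂ v' γ * o1
  rcases mul_eq_zero.mp (eq_zero_of_ne_zero_of_mul_right_eq_zero
    (right_ne_zero_of_mul (hdet ▸ hst)) hdet') with rfl | rfl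
  · have hl : l' ≠ 0 := by
      rintro rfl
      exact hne (by simpa using h2)
    have h11 : q₁ * y₁ = 0 := by simpa [hl] using f11.symm
    have h22 : q₂ * y₂ = 0 := by simpa [hl] using f22.symm
    -- Now `b' ⊗ g'` has zero diagonal, so the diagonal of `k • b ⊗ g` is `s, t` and its
    -- off-diagonal product is `s * t`. Its off-diagonal entries cancel those of `k' • b' ⊗ g'`,
    -- whose product is zero.
    refine hst ?_
    linear_combination (t : ℂ) * e11 + k * p₁ * x₁ * e22 - k * p₁ * x₂ * e21 +
      k' * q₂ * y₁ * e12 + (t * k' + k' * k' * q₂ * y₂) * h11 + k * k' * p₁ * x₁ * h22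
  · have hl : l ≠ 0 := by
      rintro rfl
      exact hne (by simpa using h2)
    have h11 : p₁ * x₁ = 0 := by simpa [hl] using f11.symm
    have h22 : p₂ * x₂ = 0 := by simpa [hl] using f22.symm
    refine hst ?_
    linear_combination (t : ℂ) * e11 + k' * q₁ * y₁ * e22 - k' * q₁ * y₂ * e21 +
      k * p₂ * x₁ * e12 + (t * k + k * k * p₂ * x₂) * h11 + k * k' * q₁ * y₁ * h22

/-! ### Reduction of the tripartite form to two parties -/

theorem IsProductVector.exists_of_three {n : ℕ} {d : Fin n → ℕ} {φ : MultiSpace d}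
    (h : IsProductVector φ) {A B C : Fin n} (hAB : A ≠ B) (hAC : A ≠ C) (hBC : B ≠ C)
    (hex : ∀ i, i = A ∨ i = B ∨ i = C) :
    ∃ (a : EuclideanSpace ℂ (Fin (d A))) (b : EuclideanSpace ℂ (Fin (d B)))
      (c : EuclideanSpace ℂ (Fin (d C))), ∀ x, φ x = a (x A) * tensorTwo b c (x B, x C) := by
  obtain ⟨a, v, hv⟩ := h
  have huniv : (Finset.univ : Finset (Fin n)) = {A, B, C} := by
    ext i
    simpa using hex i
  refine ⟨a • v A, v B, v C, fun x => ?_⟩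
  rw [hv, huniv, Finset.prod_insert (by simp [hAB, hAC]), Finset.prod_pair hBC]
  simp [tensorTwo, mul_assoc]

theorem exists_assignment_of_three {n : ℕ} {d : Fin n → ℕ} {A B C : Fin n} (hAB : A ≠ B)
    (hAC : A ≠ C) (hBC : B ≠ C) (hex : ∀ i, i = A ∨ i = B ∨ i = C) (a : Fin (d A))
    (b : Fin (d B)) (c : Fin (d C)) :
    ∃ x : (i : Fin n) → Fin (d i), x A = a ∧ x B = b ∧ x C = c := by
  have hne : ∀ i, Nonempty (Fin (d i)) := by
    intro i
    rcases hex i with rfl | rfl | rfl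
    exacts [⟨a⟩, ⟨b⟩, ⟨c⟩]
  refine ⟨Function.update (Function.update (Function.update (fun i => (hne i).some) A a) B b) C c,
    ?_, ?_, ?_⟩
  · simp [hAB, hAC]
  · simp [hBC]
  · simp

theorem not_hasRobustTripartiteForm_add {n : ℕ} {d : Fin n → ℕ} {η ω : MultiSpace d}
    (hη : IsProductVector η) (hω : IsProductVector ω) : ¬ HasRobustTripartiteForm (η + ω) := by
  rintro ⟨A, B, C, hAB, hAC, hBC, hex, c, e, α, α', Φ, Φ', hc, he, -, hα, hα', hαα, -, hΦ', -, -,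
    ⟨β, γ, rfl⟩, hST, hψ⟩
  obtain ⟨a₁, b₁, c₁, h₁⟩ := hη.exists_of_three hAB hAC hBC hex
  obtain ⟨a₂, b₂, c₂, h₂⟩ := hω.exists_of_three hAB hAC hBC hex
  have key : ∀ (a : Fin (d A)) (z : Fin (d B) × Fin (d C)),
      (c : ℂ) * (α a * Φ z) + (e : ℂ) * (α' a * tensorTwo β γ z) =
        a₁ a * tensorTwo b₁ c₁ z + a₂ a * tensorTwo b₂ c₂ z := by
    rintro a ⟨y, z⟩
    obtain ⟨x, rfl, rfl, rfl⟩ := exists_assignment_of_three hAB hAC hBC hex a y z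
    rw [← hψ, PiLp.add_apply, h₁, h₂]
  -- Partial inner product with `ν` on party `A`; orthonormality of `α, α'` then isolates `Φ` and
  -- `Φ'` in turn.
  have contract : ∀ ν : EuclideanSpace ℂ (Fin (d A)),
      ((c : ℂ) * inner ℂ ν α) • Φ + ((e : ℂ) * inner ℂ ν α') • tensorTwo β γ =
        (inner ℂ ν a₁ : ℂ) • tensorTwo b₁ c₁ + (inner ℂ ν a₂ : ℂ) • tensorTwo b₂ c₂ := by
    intro ν
    ext z
    have hz := congrArg (inner ℂ ν) (show ((c : ℂ) * Φ z) • α + ((e : ℂ) * tensorTwo β γ z) • α' =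
      tensorTwo b₁ c₁ z • a₁ + tensorTwo b₂ c₂ z • a₂ by
        ext a
        simp only [PiLp.add_apply, PiLp.smul_apply, smul_eq_mul]
        linear_combination key a z)
    simp only [inner_add_right, inner_smul_right] at hz
    simp only [PiLp.add_apply, PiLp.smul_apply, smul_eq_mul]
    linear_combination hz
  have hc' : (c : ℂ) ≠ 0 := by exact_mod_cast hc
  have he' : (e : ℂ) ≠ 0 := by exact_mod_cast he
  have k1 := contract α
  have k2 := contract α'
  rw [inner_self_eq_one_of_norm hα, hαα, mul_one, mul_zero, zero_smul, add_zero] at k1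
  rw [inner_self_eq_one_of_norm hα', inner_eq_zero_symm.mp hαα, mul_one, mul_zero, zero_smul,
    zero_add] at k2
  refine hST.not_mem_span_products (fun h => by simp [h] at hΦ') (b := b₁) (g := c₁) (b' := b₂)
    (g' := c₂) (k := (c : ℂ)⁻¹ * inner ℂ α a₁) (k' := (c : ℂ)⁻¹ * inner ℂ α a₂)
    (l := (e : ℂ)⁻¹ * inner ℂ α' a₁) (l' := (e : ℂ)⁻¹ * inner ℂ α' a₂) ?_ ?_
  · rw [← inv_smul_smul₀ hc' Φ, k1, smul_add, smul_smul, smul_smul]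
  · rw [← inv_smul_smul₀ he' (tensorTwo β γ), k2, smul_add, smul_smul, smul_smul]

theorem corollary1 {n : ℕ} (d : Fin n → ℕ) (S : Set (MultiSpace d)) (hS : IsUEB S)
    (ψ : MultiSpace d) (hψ : ψ ∈ S) (hid : IsLocallyUnambiguouslyIdentifiable S ψ) :
    ¬ HasRobustTripartiteForm ψ ∧
    ¬ ∃ T : Finset (Fin n), T.Nonempty ∧ Tᶜ.Nonempty ∧ 3 ≤ schmidtRank T ψ := by
  obtain ⟨η, ω, hη, hω, rfl⟩ := hS.exists_eq_add_of_identifiable hψ hid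
  refine ⟨not_hasRobustTripartiteForm_add hη hω, ?_⟩
  rintro ⟨T, -, -, hT⟩
  have := schmidtRank_add_le_two hη hω T
  omega
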